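/- Fix constants $\vartheta\in(0,1)$, $r>0$ and $\theta>0$. For every $p$ let $X^{(1)},X^{(2)}$ be real $n_p\times p$ design matrices with a common invertible Gram matrix $X^{(1)\top}X^{(1)}=X^{(2)\top}X^{(2)}=\Sigma_p$ such that $(\Sigma_p^{-1})_{jj}=\theta$ for all $j$ and $p$. Let $\epsilon_p=p^{-\vartheta}$, $\tau_p=\sqrt{2r\log p}$, let $\beta_1,\dots,\beta_p$ be i.i.d. from $\pi_p=(1-\epsilon_p)\delta_0+\epsilon_p\delta_{\tau_p}$, and let $y^{(k)}=X^{(k)}\beta+\epsilon^{(k)}$, $k=1,2$, where the noises $\epsilon^{(k)}\sim N(0,I_{n_p})$ are independent of each other and of $\beta$. Let $\hat\beta^{(k)}=(X^{(k)\top}X^{(k)})^{-1}X^{(k)\top}y^{(k)}$. The sign-sum statistic is $M_j=\operatorname{sgn}(\hat\beta^{(1)}_j\hat\beta^{(2)}_j)\,(|\hat\beta^{(1)}_j|+|\hat\beta^{(2)}_j|)$. The marginal-posterior statistic is $$\widetilde M_j=\log\frac{\mathbb E_{\beta_j\mid\hat\beta_j^{(1)}}\,p(\hat\beta_j^{(2)}\mid\beta_j)}{\mathbb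 E_{\beta_j\mid\hat\beta_j^{(1)}}\,p(-\hat\beta_j^{(2)}\mid\beta_j)},$$ where $p(\cdot\mid b)$ is the density of $N(b,\theta)$, which is the conditional law of $\hat\beta^{(k)}_j$ given $\beta_j=b$, and $\mathbb E_{\beta_j\mid\hat\beta_j^{(1)}}$ is the expectation over the posterior of $\beta_j$ given $\hat\beta^{(1)}_j$ under the prior $\pi_p$. With $S_1=\{j:\beta_j\neq0\}$ put $\mathrm{Hamm}_W(t)=\mathbb E|\{j:W_j\ge t\}\setminus S_1|+\mathbb E|S_1\setminus\{j:W_j\ge t\}|$, and let $$\mathrm{Hamm}^\star_{M}=\inf_{u>0}\mathrm{Hamm}_M(\sqrt{2u\log p}),\qquad \mathrm{Hamm}^\star_{\widetilde M}=\inf_{u>0}\mathrm{Hamm}_{\widetilde M}(2u\log p).$$ Then, with $\bar r=2r/\theta$, $\widetilde M$ and $M$ have the same Hamming-rate exponent $$f^\star=1-\vartheta-\frac{(\bar r-\vartheta)_+^2}{4\bar r},$$ that is, $\mathrm{Hamm}^\star_{\widetilde M}=L_p\,p^{f^\star}$ and $\mathrm{Hamm}^\star_{M}=L'_p\,p^{f^\star}$,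 where $L_p,L'_p$ are multi-log terms (for some constant $C$, they lie between $(\log p)^{-C}$ and $(\log p)^{C}$ for all large $p$). For $\theta=2$, where $\bar r=r$, the exponent is $1-\vartheta-(r-\vartheta)_+^2/(4r)$. Moreover, $$\limsup_{p\to\infty}\frac{\mathrm{Hamm}^\star_{\widetilde M}}{\mathrm{Hamm}^\star_{M}}\le1.$$ -/

import Mathlib

open MeasureTheory ProbabilityTheory Filter
open scoped Matrix ENNReal

noncomputable section

namespace RareWeak

/-- Expected signal fraction `ε_p = p ^ (-ϑ)`. -/
def eps (ϑ : ℝ) (p : ℕ) : ℝ := (p : ℝ) ^ (-ϑ)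

/-- Signal strength `τ_p = √(2 r log p)`. -/
def tau (r : ℝ) (p : ℕ) : ℝ := Real.sqrt (2 * r * Real.log p)

/-- The spike-and-slab prior of one coefficient, `(1 - ε_p) δ_0 + ε_p δ_{τ_p}`. -/
def prior (ϑ r : ℝ) (p : ℕ) : Measure ℝ :=
  ENNReal.ofReal (1 - eps ϑ p) • Measure.dirac 0
    + ENNReal.ofReal (eps ϑ p) • Measure.dirac (tau r p)

/-- A realization of the model: the coefficient vector and the noise vectors of the two halves. -/
structure Sample (n p : ℕ) where
  beta : Fin p → ℝ
  noise₁ : Fin n → ℝ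
  noise₂ : Fin n → ℝ

/-- Joint law of `(β, ε⁽¹⁾, ε⁽²⁾)`: the `β_j` are i.i.d. from the prior, the noise entries are
i.i.d. standard normal, and the three vectors are independent. -/
def law (ϑ r : ℝ) (n p : ℕ) : Measure ((Fin p → ℝ) × (Fin n → ℝ) × (Fin n → ℝ)) :=
  (Measure.pi fun _ => prior ϑ r p).prod
    ((Measure.pi fun _ => gaussianReal 0 1).prod (Measure.pi fun _ => gaussianReal 0 1))

/-- View a point of the product space as a realization of the model. -/
def toSample {n p : ℕ} (ω : (Fin p → ℝ) × (Fin n → ℝ) × (Fin n → ℝ)) : Sample n p :=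
  ⟨ω.1, ω.2.1, ω.2.2⟩

/-- Ordinary least squares estimate `(XᵀX)⁻¹ Xᵀ y`. -/
def ols {n p : ℕ} (X : Matrix (Fin n) (Fin p) ℝ) (y : Fin n → ℝ) : Fin p → ℝ :=
  (Xᵀ * X)⁻¹ *ᵥ (Xᵀ *ᵥ y)

/-- Least squares estimate in the first half, where `y⁽¹⁾ = X⁽¹⁾ β + ε⁽¹⁾`. -/
def betaHat₁ {n p : ℕ} (X₁ : Matrix (Fin n) (Fin p) ℝ) (s : Sample n p) : Fin p → ℝ :=
  ols X₁ (X₁ *ᵥ s.beta + s.noise₁)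

/-- Least squares estimate in the second half, where `y⁽²⁾ = X⁽²⁾ β + ε⁽²⁾`. -/
def betaHat₂ {n p : ℕ} (X₂ : Matrix (Fin n) (Fin p) ℝ) (s : Sample n p) : Fin p → ℝ :=
  ols X₂ (X₂ *ᵥ s.beta + s.noise₂)

/-- The sign-sum mirror statistic `M_j`. -/
def signSum {n p : ℕ} (X₁ X₂ : Matrix (Fin n) (Fin p) ℝ) (s : Sample n p) (j : Fin p) : ℝ :=
  Real.sign (betaHat₁ X₁ s j * betaHat₂ X₂ s j) * (|betaHat₁ X₁ s j| + |betaHat₂ X₂ s j|)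

/-- The sampling density at `x` of the `j`-th least squares estimate given `β_j = b`, that is, the
density of `N(b, ((XᵀX)⁻¹)_{jj})`. -/
def likelihood {n p : ℕ} (X : Matrix (Fin n) (Fin p) ℝ) (j : Fin p) (b x : ℝ) : ℝ :=
  gaussianPDFReal b ((Xᵀ * X)⁻¹ j j).toNNReal x

/-- The marginal posterior expectation of `g(β_j)` given that the `j`-th least squares estimate
is `x`, by Bayes' formula, for the prior `π` of `β_j`. -/
def posteriorMean {n p : ℕ} (π : Measure ℝ) (X : Matrix (Fin n) (Fin p) ℝ) (j : Fin p) (x : ℝ)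
    (g : ℝ → ℝ) : ℝ :=
  (∫ b, g b * likelihood X j b x ∂π) / ∫ b, likelihood X j b x ∂π

/-- The marginal-posterior mirror statistic `M̃_j`: the logarithm of the ratio of the posterior
means given `β̂_j⁽¹⁾` of the density of the second estimate at `β̂_j⁽²⁾` and at `-β̂_j⁽²⁾`. -/
def marginalMirror {n p : ℕ} (π : Measure ℝ) (X₁ X₂ : Matrix (Fin n) (Fin p) ℝ)
    (s : Sample n p) (j : Fin p) : ℝ :=
  Real.log
    (posteriorMean π X₁ j (betaHat₁ X₁ s j) (fun b => likelihood X₂ j b (betaHat₂ X₂ s j))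
      / posteriorMean π X₁ j (betaHat₁ X₁ s j) (fun b => likelihood X₂ j b (-betaHat₂ X₂ s j)))

/-- The truly relevant features. -/
def relevant {n p : ℕ} (s : Sample n p) : Set (Fin p) := {j | s.beta j ≠ 0}

/-- The selected features at threshold `t` for the importance measure `W`. -/
def selected {n p : ℕ} (W : Sample n p → Fin p → ℝ) (t : ℝ) (s : Sample n p) : Set (Fin p) :=
  {j | t ≤ W s j}

/-- Expected number of false positives at threshold `t`. -/
def falsePos (ϑ r : ℝ) {n p : ℕ} (W : Sample n p → Fin p → ℝ) (t : ℝ) : ℝ≥0∞ :=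
  ∫⁻ ω, ((selected W t (toSample ω) \ relevant (toSample ω)).ncard : ℝ≥0∞) ∂(law ϑ r n p)

/-- Expected number of false negatives at threshold `t`. -/
def falseNeg (ϑ r : ℝ) {n p : ℕ} (W : Sample n p → Fin p → ℝ) (t : ℝ) : ℝ≥0∞ :=
  ∫⁻ ω, ((relevant (toSample ω) \ selected W t (toSample ω)).ncard : ℝ≥0∞) ∂(law ϑ r n p)

/-- Expected Hamming error at threshold `t`. -/
def hamm (ϑ r : ℝ) {n p : ℕ} (W : Sample n p → Fin p → ℝ) (t : ℝ) : ℝ≥0∞ :=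
  falsePos ϑ r W t + falseNeg ϑ r W t

/-- Minimal Hamming error of the sign-sum statistic over the thresholds `√(2 u log p)`, `u > 0`. -/
def hammStarSignSum (ϑ r : ℝ) {n p : ℕ} (X₁ X₂ : Matrix (Fin n) (Fin p) ℝ) : ℝ≥0∞ :=
  ⨅ (u : ℝ) (_ : 0 < u), hamm ϑ r (signSum X₁ X₂) (Real.sqrt (2 * u * Real.log p))

/-- Minimal Hamming error of the marginal-posterior statistic, computed with the true prior, over
the thresholds `2 u log p`, `u > 0`. -/
def hammStarMarginal (ϑ r : ℝ) {n p : ℕ} (X₁ X₂ : Matrix (Fin n) (Fin p) ℝ) : ℝ≥0∞ :=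
  ⨅ (u : ℝ) (_ : 0 < u), hamm ϑ r (marginalMirror (prior ϑ r p) X₁ X₂) (2 * u * Real.log p)

/-- A multi-log term: eventually between two powers of `log p`. -/
def IsMultiLog (L : ℕ → ℝ) : Prop :=
  ∃ C : ℝ, ∀ᶠ p : ℕ in atTop, (Real.log p) ^ (-C) ≤ L p ∧ L p ≤ (Real.log p) ^ C

/-- `H p = L_p p ^ f` with a multi-log term `L_p`. -/
def HasHammingRate (H : ℕ → ℝ≥0∞) (f : ℝ) : Prop :=
  ∃ L : ℕ → ℝ, IsMultiLog L ∧ ∀ᶠ p : ℕ in atTop, H p = ENNReal.ofReal (L p * (p : ℝ) ^ f)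

end RareWeak

end

/-! For each `j` the two least squares estimates are, given `β_j`, independent with law `N(β_j, θ)`:
the rows of `(XᵀX)⁻¹Xᵀ` have squared norm `((XᵀX)⁻¹)_jj = θ`. Correlations between coordinates do
not affect an expected count, so the Hamming error of a coordinatewise statistic is `p` times the
prior risk of a test of `N(0,θ)²` against `N(τ,θ)²` (`hamm_eq_card_mul_risk`). Every such risk is at
least the Bayes risk, the integral of `min((1-ε)φ₀, εφ_τ)`. Write `B_p` for `p` times the Bayes
risk.

Three estimates suffice, with `b = 2r/θ` and `f` the claimed exponent. (1) `B_p ≥ c p^f / log p`, by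
integrating over a corner box where the signal term is the minimum (`exists_le_bayesRisk`). (2) The
sign-sum statistic at the Bayes boundary for `z₁ + z₂` has error at most `5 p^f`, by Chernoff bounds
(`risk_signSumFun_le_rpow`). (3) The marginal-posterior statistic at the constant threshold `log 2`
has error at most `K_p B_p` with `K_p → 1` (`risk_marginalFun_le_mul_bayesRisk`): its rejection
region is `G₁ ≥ G₀ + 2G₁'`, where `G₀` and `G₁` are the null and signal terms and `G₁'` is the
signal term reflected in `z₂`. This differs from the Bayes region `G₁ ≥ G₀` only by a term
negligible away from `z₂ ≤ τ/4`.

Since `B_p` bounds both optimal errors from below, (1)-(3) give both rates, and (3) alone gives the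
ratio. -/

namespace RareWeak

open scoped NNReal

/-! ### Gaussian laws and tail bounds -/

/-- A linear combination of independent standard normal variables is centred normal. -/
theorem map_sum_pi_gaussianReal {ι : Type*} [Fintype ι] (a : ι → ℝ) :
    (Measure.pi fun _ : ι => gaussianReal 0 1).map (fun x => ∑ i, a i * x i) =
      gaussianReal 0 (∑ i, a i ^ 2).toNNReal := by
  have hm : Measurable (fun x : ι → ℝ => ∑ i, a i * x i) := by fun_prop
  have : IsProbabilityMeasure
      ((Measure.pi fun _ : ι => gaussianReal 0 1).map (fun x => ∑ i, a i * x i)) :=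
    Measure.isProbabilityMeasure_map hm.aemeasurable
  refine Measure.ext_of_charFun ?_
  ext t
  rw [charFun_gaussianReal, charFun_apply_real, integral_map hm.aemeasurable (by fun_prop)]
  have h1 : ∀ x : ι → ℝ, Complex.exp (t * ((∑ i, a i * x i : ℝ) : ℂ) * Complex.I)
      = ∏ i, Complex.exp (((t * a i : ℝ) : ℂ) * (x i : ℂ) * Complex.I) := by
    intro x
    rw [← Complex.exp_sum]
    congr 1
    push_cast
    rw [Finset.mul_sum, Finset.sum_mul]
    refine Finset.sum_congr rfl fun i _ => ?_
    ring
  simp_rw [h1]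
  rw [integral_fintype_prod_eq_prod
    (f := fun i (x : ℝ) => Complex.exp (((t * a i : ℝ) : ℂ) * (x : ℂ) * Complex.I))]
  simp_rw [← charFun_apply_real, charFun_gaussianReal]
  rw [← Complex.exp_sum]
  congr 1
  have h2 : (((∑ i, a i ^ 2).toNNReal : ℝ) : ℂ) = ∑ i, (a i : ℂ) ^ 2 := by
    rw [Real.coe_toNNReal _ (Finset.sum_nonneg fun i _ => sq_nonneg _)]
    push_cast
    rfl
  rw [h2]
  simp only [Complex.ofReal_zero, mul_zero, zero_mul, zero_sub, NNReal.coe_one, Complex.ofReal_one,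
    one_mul]
  rw [Finset.sum_neg_distrib, Finset.sum_mul, Finset.sum_div]
  congr 1
  refine Finset.sum_congr rfl fun i _ => ?_
  push_cast
  ring

/-- Chernoff bound for the upper tail of a centred normal law. -/
theorem gaussianReal_Ici_le (v : ℝ≥0) {t : ℝ} (ht : 0 ≤ t) :
    gaussianReal 0 v {x | t ≤ x} ≤ ENNReal.ofReal (Real.exp (-t ^ 2 / (2 * v))) := by
  have h : HasSubgaussianMGF (id : ℝ → ℝ) v (gaussianReal 0 v) :=
    ⟨fun s => by simpa using integrable_exp_mul_gaussianReal (μ := 0) (v := v) s,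
      fun s => by rw [mgf_id_gaussianReal]; simp⟩
  have h1 := h.measure_ge_le ht
  rw [← ENNReal.ofReal_toReal (measure_ne_top (gaussianReal 0 v) {x | t ≤ x})]
  exact ENNReal.ofReal_le_ofReal h1

/-- Chernoff bound for the lower tail of a normal law. -/
theorem gaussianReal_Iic_le (m : ℝ) (v : ℝ≥0) {t : ℝ} (ht : t ≤ m) :
    gaussianReal m v {x | x ≤ t} ≤ ENNReal.ofReal (Real.exp (-(m - t) ^ 2 / (2 * v))) := by
  have h := gaussianReal_map_const_sub (μ := 0) (v := v) m
  rw [sub_zero] at h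
  rw [← h, Measure.map_apply (by fun_prop) (show MeasurableSet {x : ℝ | x ≤ t} from measurableSet_Iic)]
  refine le_trans (le_of_eq ?_) (gaussianReal_Ici_le v (sub_nonneg.2 ht))
  congr 1
  ext x
  simp only [Set.mem_preimage, Set.mem_ofPred_eq]
  constructor <;> intro h <;> linarith

/-- The product of two copies of a normal law. -/
noncomputable abbrev pairLaw (m : ℝ) (v : ℝ≥0) : Measure (ℝ × ℝ) :=
  (gaussianReal m v).prod (gaussianReal m v)

theorem pairLaw_add_ge_le (v : ℝ≥0) {t : ℝ} (ht : 0 ≤ t) :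
    pairLaw 0 v {z | t ≤ z.1 + z.2} ≤ ENNReal.ofReal (Real.exp (-t ^ 2 / (4 * v))) := by
  have h := gaussianReal_conv_gaussianReal (m₁ := 0) (m₂ := 0) (v₁ := v) (v₂ := v)
  rw [Measure.conv] at h
  have h1 := gaussianReal_Ici_le (v + v) ht
  rw [add_zero] at h
  rw [← h, Measure.map_apply (by fun_prop) (show MeasurableSet {x : ℝ | t ≤ x} from measurableSet_Ici)] at h1
  refine h1.trans (ENNReal.ofReal_le_ofReal (le_of_eq ?_))
  congr 2
  push_cast
  ring

theorem pairLaw_add_le_le (m : ℝ) (v : ℝ≥0) {t : ℝ} (ht : t ≤ 2 * m) :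
    pairLaw m v {z | z.1 + z.2 ≤ t} ≤ ENNReal.ofReal (Real.exp (-(2 * m - t) ^ 2 / (4 * v))) := by
  have h := gaussianReal_conv_gaussianReal (m₁ := m) (m₂ := m) (v₁ := v) (v₂ := v)
  rw [Measure.conv, ← two_mul] at h
  have h1 := gaussianReal_Iic_le (2 * m) (v + v) ht
  rw [← h, Measure.map_apply (by fun_prop) (show MeasurableSet {x : ℝ | x ≤ t} from measurableSet_Iic)] at h1
  refine h1.trans (ENNReal.ofReal_le_ofReal (le_of_eq ?_))
  congr 2
  push_cast
  ring

theorem pairLaw_fst_le_le (m : ℝ) (v : ℝ≥0) {t : ℝ} (ht : t ≤ m) :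
    pairLaw m v {z | z.1 ≤ t} ≤ ENNReal.ofReal (Real.exp (-(m - t) ^ 2 / (2 * v))) := by
  have h : {z : ℝ × ℝ | z.1 ≤ t} = {x | x ≤ t} ×ˢ Set.univ := by ext; simp
  rw [h, Measure.prod_prod, measure_univ, mul_one]
  exact gaussianReal_Iic_le m v ht

theorem pairLaw_snd_le_le (m : ℝ) (v : ℝ≥0) {t : ℝ} (ht : t ≤ m) :
    pairLaw m v {z | z.2 ≤ t} ≤ ENNReal.ofReal (Real.exp (-(m - t) ^ 2 / (2 * v))) := by
  have h : {z : ℝ × ℝ | z.2 ≤ t} = Set.univ ×ˢ {x | x ≤ t} := by ext; simp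
  rw [h, Measure.prod_prod, measure_univ, one_mul]
  exact gaussianReal_Iic_le m v ht

/-- Lower bound for the lower tail of a normal law, sharp up to a factor linear in `k`. -/
theorem le_gaussianReal_Iic (m : ℝ) {v : ℝ≥0} (hv : v ≠ 0) {k : ℝ} (hk : 0 ≤ k) :
    ENNReal.ofReal ((k + 1)⁻¹ * (√(2 * Real.pi))⁻¹ * Real.exp (-(k ^ 2 + 3) / 2)) ≤
      gaussianReal m v {x | x ≤ m - √v * k} := by
  have hv0 : (0 : ℝ) < v := by positivity
  have hs : 0 < √(v : ℝ) := Real.sqrt_pos.2 hv0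
  have hk1 : 0 < k + 1 := by linarith
  -- An interval of relative width `h = 1/(k+1)` just below the cutoff is enough: `(k+h)² ≤ k² + 2kh
  -- + 1 ≤ k² + 3`, so the density drops only by a bounded factor across it.
  set h : ℝ := (k + 1)⁻¹ with hh
  have hh0 : 0 < h := by positivity
  have hh1 : h ≤ 1 := inv_le_one_of_one_le₀ (by linarith)
  have hkh : k * h ≤ 1 := by
    rw [hh, ← div_eq_mul_inv, div_le_one hk1]; linarith
  have hsub : Set.Icc (m - √v * (k + h)) (m - √v * k) ⊆ {x | x ≤ m - √v * k} := fun x hx => hx.2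
  refine le_trans ?_ (measure_mono hsub)
  rw [gaussianReal_apply m hv]
  have hpt : ∀ x ∈ Set.Icc (m - √v * (k + h)) (m - √v * k),
      ENNReal.ofReal ((√(2 * Real.pi * v))⁻¹ * Real.exp (-(k ^ 2 + 3) / 2)) ≤
        gaussianPDF m v x := by
    intro x hx
    refine ENNReal.ofReal_le_ofReal ?_
    rw [gaussianPDFReal_def]
    refine mul_le_mul_of_nonneg_left (Real.exp_le_exp.2 ?_) (by positivity)
    rw [neg_div, neg_div, neg_le_neg_iff, div_le_div_iff₀ (by positivity) (by positivity)]
    have h1 : (x - m) ^ 2 ≤ (√v * (k + h)) ^ 2 := by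
      refine sq_le_sq' (by linarith [hx.1]) ?_
      have : 0 ≤ √(v : ℝ) * k := by positivity
      have : 0 ≤ √(v : ℝ) * (k + h) := by positivity
      linarith [hx.2]
    have h2 : (√(v : ℝ) * (k + h)) ^ 2 = v * (k + h) ^ 2 := by
      rw [mul_pow, Real.sq_sqrt hv0.le]
    have h3 : (k + h) ^ 2 ≤ k ^ 2 + 3 := by nlinarith
    nlinarith
  refine le_trans ?_ (setLIntegral_mono (measurable_gaussianPDF m v) hpt)
  rw [setLIntegral_const, Real.volume_Icc, ← ENNReal.ofReal_mul (by positivity)]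
  refine ENNReal.ofReal_le_ofReal (le_of_eq ?_)
  rw [Real.sqrt_mul (by positivity) (v : ℝ), mul_inv]
  field_simp
  ring

/-- The box lies in the half-plane `z₁ + z₂ ≤ 2(m - √v k)` and touches its boundary at the diagonal
point, where the density on that half-plane is largest. Hence the box has the same exponential rate
`k²` as the half-plane and loses only a polynomial factor. -/
theorem le_pairLaw_box (m : ℝ) {v : ℝ≥0} (hv : v ≠ 0) {k : ℝ} (hk : 0 ≤ k) :
    ENNReal.ofReal ((k + 1)⁻¹ ^ 2 * (2 * Real.pi)⁻¹ * Real.exp (-(k ^ 2 + 3))) ≤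
      pairLaw m v {z | z.1 ≤ m - √v * k ∧ z.2 ≤ m - √v * k} := by
  have h : {z : ℝ × ℝ | z.1 ≤ m - √v * k ∧ z.2 ≤ m - √v * k} =
    {x | x ≤ m - √v * k} ×ˢ {x | x ≤ m - √v * k} := by ext; simp
  rw [h, Measure.prod_prod]
  refine le_trans (le_of_eq ?_)
    (mul_le_mul' (le_gaussianReal_Iic m hv hk) (le_gaussianReal_Iic m hv hk))
  rw [← ENNReal.ofReal_mul (by positivity)]
  congr 1
  have h1 : Real.exp (-(k ^ 2 + 3)) = Real.exp (-(k ^ 2 + 3) / 2) * Real.exp (-(k ^ 2 + 3) / 2) := by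
    rw [← Real.exp_add]; congr 1; ring
  have h2 : (2 * Real.pi)⁻¹ = (√(2 * Real.pi))⁻¹ * (√(2 * Real.pi))⁻¹ := by
    rw [← mul_inv, Real.mul_self_sqrt (by positivity)]
  rw [h1, h2]
  ring

/-! ### Law of the least squares estimates -/

theorem ols_model {n p : ℕ} (X : Matrix (Fin n) (Fin p) ℝ) (h : IsUnit (Xᵀ * X))
    (b : Fin p → ℝ) (e : Fin n → ℝ) (j : Fin p) :
    ols X (X *ᵥ b + e) j = b j + ∑ i, ((Xᵀ * X)⁻¹ * Xᵀ) j i * e i := by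
  rw [ols, Matrix.mulVec_mulVec, Matrix.mulVec_add, Matrix.mulVec_mulVec, Matrix.mul_assoc,
    Matrix.nonsing_inv_mul _ ((Matrix.isUnit_iff_isUnit_det _).1 h), Matrix.one_mulVec]
  rfl

theorem sum_sq_ols_row {n p : ℕ} (X : Matrix (Fin n) (Fin p) ℝ) (h : IsUnit (Xᵀ * X))
    (j : Fin p) : ∑ i, ((Xᵀ * X)⁻¹ * Xᵀ) j i ^ 2 = (Xᵀ * X)⁻¹ j j := by
  have h1 : ((Xᵀ * X)⁻¹ * Xᵀ) * ((Xᵀ * X)⁻¹ * Xᵀ)ᵀ = (Xᵀ * X)⁻¹ := by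
    rw [Matrix.transpose_mul, Matrix.transpose_transpose, Matrix.transpose_nonsing_inv,
      Matrix.transpose_mul, Matrix.transpose_transpose, Matrix.mul_assoc, ← Matrix.mul_assoc Xᵀ,
      Matrix.mul_nonsing_inv _ ((Matrix.isUnit_iff_isUnit_det _).1 h), Matrix.mul_one]
  conv_rhs => rw [← h1]
  rw [Matrix.mul_apply]
  refine Finset.sum_congr rfl fun i _ => ?_
  rw [Matrix.transpose_apply, sq]

/-- A zero diagonal entry would make a row of the left inverse `(XᵀX)⁻¹Xᵀ` of `X` vanish, against
the diagonal entry `1` of the identity. -/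
theorem inv_gram_diag_pos {n p : ℕ} (X : Matrix (Fin n) (Fin p) ℝ) (h : IsUnit (Xᵀ * X))
    (j : Fin p) : 0 < (Xᵀ * X)⁻¹ j j := by
  have h0 : 0 ≤ (Xᵀ * X)⁻¹ j j := by
    rw [← sum_sq_ols_row X h j]; exact Finset.sum_nonneg fun i _ => sq_nonneg _
  refine lt_of_le_of_ne h0 fun h1 => ?_
  rw [← sum_sq_ols_row X h j] at h1
  have h2 := (Finset.sum_eq_zero_iff_of_nonneg fun i _ => sq_nonneg _).1 h1.symm
  have h3 : ((Xᵀ * X)⁻¹ * Xᵀ * X) j j = 0 := by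
    rw [Matrix.mul_apply]
    refine Finset.sum_eq_zero fun i hi => ?_
    rw [(pow_eq_zero_iff two_ne_zero).1 (h2 i hi), zero_mul]
  rw [Matrix.mul_assoc, Matrix.nonsing_inv_mul _ ((Matrix.isUnit_iff_isUnit_det _).1 h),
    Matrix.one_apply_eq] at h3
  exact one_ne_zero h3

theorem isProbabilityMeasure_prior {ϑ r : ℝ} {p : ℕ} (h0 : 0 ≤ eps ϑ p) (h1 : eps ϑ p ≤ 1) :
    IsProbabilityMeasure (prior ϑ r p) := by
  constructor
  rw [prior, Measure.add_apply, Measure.smul_apply, Measure.smul_apply, measure_univ, measure_univ,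
    smul_eq_mul, smul_eq_mul, mul_one, mul_one, ← ENNReal.ofReal_add (by linarith) h0]
  simp

/-- The joint law of one coefficient and of the errors of its two least squares estimates. -/
theorem measurePreserving_coordinate {ϑ r θ : ℝ} {n p : ℕ}
    [IsProbabilityMeasure (prior ϑ r p)] (X₁ X₂ : Matrix (Fin n) (Fin p) ℝ)
    (h₁ : IsUnit (X₁ᵀ * X₁)) (h₂ : IsUnit (X₂ᵀ * X₂)) (j : Fin p)
    (hd₁ : (X₁ᵀ * X₁)⁻¹ j j = θ) (hd₂ : (X₂ᵀ * X₂)⁻¹ j j = θ) :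
    MeasurePreserving
      (fun ω : (Fin p → ℝ) × (Fin n → ℝ) × (Fin n → ℝ) =>
        (ω.1 j, (∑ i, ((X₁ᵀ * X₁)⁻¹ * X₁ᵀ) j i * ω.2.1 i, ∑ i, ((X₂ᵀ * X₂)⁻¹ * X₂ᵀ) j i * ω.2.2 i)))
      (law ϑ r n p) ((prior ϑ r p).prod (pairLaw 0 θ.toNNReal)) := by
  have key : ∀ X : Matrix (Fin n) (Fin p) ℝ, IsUnit (Xᵀ * X) → (Xᵀ * X)⁻¹ j j = θ →
      MeasurePreserving (fun e : Fin n → ℝ => ∑ i, ((Xᵀ * X)⁻¹ * Xᵀ) j i * e i)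
        (Measure.pi fun _ => gaussianReal 0 1) (gaussianReal 0 θ.toNNReal) := by
    intro X hX hd
    refine ⟨by fun_prop, ?_⟩
    rw [map_sum_pi_gaussianReal, sum_sq_ols_row X hX, hd]
  exact (measurePreserving_eval (fun _ : Fin p => prior ϑ r p) j).prod
    ((key X₁ h₁ hd₁).prod (key X₂ h₂ hd₂))

theorem pairLaw_eq_map (m : ℝ) (v : ℝ≥0) :
    pairLaw m v = (pairLaw 0 v).map (fun z => (m + z.1, m + z.2)) := by
  have h : MeasurePreserving (fun x : ℝ => m + x) (gaussianReal 0 v) (gaussianReal m v) :=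
    ⟨by fun_prop, by rw [gaussianReal_map_const_add, zero_add]⟩
  exact (h.prod h).map_eq.symm

/-! ### Hamming error as the risk of a test on one coordinate -/

theorem lintegral_ncard {Ω : Type*} [MeasurableSpace Ω] {p : ℕ} (μ : Measure Ω)
    (S : Ω → Set (Fin p)) (hS : ∀ j, MeasurableSet {ω | j ∈ S ω}) :
    ∫⁻ ω, ((S ω).ncard : ℝ≥0∞) ∂μ = ∑ j, μ {ω | j ∈ S ω} := by
  classical
  have h : ∀ ω, ((S ω).ncard : ℝ≥0∞) = ∑ j, Set.indicator {ω | j ∈ S ω} 1 ω := by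
    intro ω
    rw [Set.ncard_eq_toFinset_card' (S ω)]
    simp [Set.indicator_apply, Finset.sum_boole, Set.toFinset]
  simp_rw [h]
  rw [lintegral_finsetSum _ fun j _ => measurable_one.indicator (hS j)]
  refine Finset.sum_congr rfl fun j _ => lintegral_indicator_one (hS j)

/-- The risk of the test that rejects `β_j = 0` on `S`, weighted by the prior. -/
noncomputable def risk (ε τ : ℝ) (v : ℝ≥0) (S : Set (ℝ × ℝ)) : ℝ≥0∞ :=
  ENNReal.ofReal (1 - ε) * pairLaw 0 v S + ENNReal.ofReal ε * pairLaw τ v Sᶜ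

theorem prior_prod_apply {ϑ r : ℝ} {p : ℕ} (ν : Measure (ℝ × ℝ)) [SFinite ν]
    {A : Set (ℝ × ℝ × ℝ)} (hA : MeasurableSet A) :
    (prior ϑ r p).prod ν A = ENNReal.ofReal (1 - eps ϑ p) * ν {z | (0, z) ∈ A}
      + ENNReal.ofReal (eps ϑ p) * ν {z | (tau r p, z) ∈ A} := by
  rw [Measure.prod_apply hA, prior, lintegral_add_measure, lintegral_smul_measure,
    lintegral_smul_measure, lintegral_dirac' _ (measurable_measure_prodMk_left hA),
    lintegral_dirac' _ (measurable_measure_prodMk_left hA)]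
  rfl

/-- The expected Hamming error of a coordinatewise statistic is `p` times the prior risk of the
corresponding test. -/
theorem hamm_eq_card_mul_risk {ϑ r θ : ℝ} {n p : ℕ} (X₁ X₂ : Matrix (Fin n) (Fin p) ℝ)
    (h₁ : IsUnit (X₁ᵀ * X₁)) (h₂ : IsUnit (X₂ᵀ * X₂))
    (hd₁ : ∀ j, (X₁ᵀ * X₁)⁻¹ j j = θ) (hd₂ : ∀ j, (X₂ᵀ * X₂)⁻¹ j j = θ)
    (h0 : 0 ≤ eps ϑ p) (h1 : eps ϑ p ≤ 1) (hτ : tau r p ≠ 0)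
    (W : Sample n p → Fin p → ℝ) (g : ℝ × ℝ → ℝ) (hg : Measurable g)
    (hW : ∀ s j, W s j = g (betaHat₁ X₁ s j, betaHat₂ X₂ s j)) (t : ℝ) :
    hamm ϑ r W t = p * risk (eps ϑ p) (tau r p) θ.toNNReal {z | t ≤ g z} := by
  have := isProbabilityMeasure_prior (r := r) h0 h1
  set T : Fin p → (Fin p → ℝ) × (Fin n → ℝ) × (Fin n → ℝ) → ℝ × ℝ × ℝ := fun j ω =>
        (ω.1 j, (∑ i, ((X₁ᵀ * X₁)⁻¹ * X₁ᵀ) j i * ω.2.1 i, ∑ i, ((X₂ᵀ * X₂)⁻¹ * X₂ᵀ) j i * ω.2.2 i))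
    with hT
  have hmp : ∀ j, MeasurePreserving (T j) (law ϑ r n p)
      ((prior ϑ r p).prod (pairLaw 0 θ.toNNReal)) := fun j =>
    measurePreserving_coordinate X₁ X₂ h₁ h₂ j (hd₁ j) (hd₂ j)
  have hWT : ∀ j ω, W (toSample ω) j
      = g ((T j ω).1 + (T j ω).2.1, (T j ω).1 + (T j ω).2.2) := by
    intro j ω
    rw [hW, betaHat₁, betaHat₂, ols_model X₁ h₁, ols_model X₂ h₂]
    rfl
  set A : Set (ℝ × ℝ × ℝ) := {q | t ≤ g (q.1 + q.2.1, q.1 + q.2.2)} with hA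
  have hAm : MeasurableSet A :=
    measurableSet_le measurable_const (hg.comp (by fun_prop))
  have hZ : MeasurableSet {q : ℝ × ℝ × ℝ | q.1 = 0} :=
    measurableSet_eq_fun measurable_fst measurable_const
  have hFP : falsePos ϑ r W t = p * (ENNReal.ofReal (1 - eps ϑ p) *
      pairLaw 0 θ.toNNReal {z | t ≤ g z}) := by
    have hset : ∀ j, {ω | j ∈ selected W t (toSample ω) \ relevant (toSample ω)}
        = T j ⁻¹' (A ∩ {q | q.1 = 0}) := by
      intro j
      ext ω
      simp only [selected, relevant, Set.mem_sdiff, Set.mem_ofPred_eq, not_not, Set.mem_preimage,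
        Set.mem_inter_iff, hA, hWT j ω]
      rfl
    rw [falsePos, lintegral_ncard _ _ fun j => by
      rw [hset]; exact (hmp j).measurable (hAm.inter hZ)]
    simp_rw [hset, fun j => (hmp j).measure_preimage (hAm.inter hZ).nullMeasurableSet]
    rw [Finset.sum_const, Finset.card_univ, Fintype.card_fin, nsmul_eq_mul,
      prior_prod_apply _ (hAm.inter hZ)]
    congr 1
    -- As `τ ≠ 0`, the event `β_j = 0` is exactly the null atom of the prior, so only the first
    -- summand survives.
    simp [hA, hτ]
  have hFN : falseNeg ϑ r W t = p * (ENNReal.ofReal (eps ϑ p) *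
      pairLaw (tau r p) θ.toNNReal {z | t ≤ g z}ᶜ) := by
    have hset : ∀ j, {ω | j ∈ relevant (toSample ω) \ selected W t (toSample ω)}
        = T j ⁻¹' (Aᶜ ∩ {q | q.1 = 0}ᶜ) := by
      intro j
      ext ω
      simp only [selected, relevant, Set.mem_sdiff, Set.mem_ofPred_eq, Set.mem_preimage,
        Set.mem_inter_iff, Set.mem_compl_iff, hA, hWT j ω]
      rw [and_comm]
      rfl
    have hm := hAm.compl.inter hZ.compl
    rw [falseNeg, lintegral_ncard _ _ fun j => by
      rw [hset]; exact (hmp j).measurable hm]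
    simp_rw [hset, fun j => (hmp j).measure_preimage hm.nullMeasurableSet]
    rw [Finset.sum_const, Finset.card_univ, Fintype.card_fin, nsmul_eq_mul,
      prior_prod_apply _ hm, pairLaw_eq_map (tau r p), Measure.map_apply (by fun_prop)
        (measurableSet_le measurable_const hg).compl]
    congr 1
    simp only [Set.mem_inter_iff, Set.mem_compl_iff, Set.mem_ofPred_eq, not_true_eq_false, and_false,
      Set.ofPred_false, measure_empty, mul_zero, zero_add, hτ, not_false_eq_true, and_true, hA]
    rfl
  rw [hamm, hFP, hFN, ← mul_add, risk]

/-! ### The two statistics as functions of the pair of estimates -/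

/-- The sign-sum statistic as a function of the two estimates. -/
noncomputable def signSumFun (z : ℝ × ℝ) : ℝ := Real.sign (z.1 * z.2) * (|z.1| + |z.2|)

theorem measurable_signSumFun : Measurable signSumFun := by
  have h : Measurable Real.sign := by
    unfold Real.sign
    exact Measurable.ite measurableSet_Iio measurable_const
      (Measurable.ite measurableSet_Ioi measurable_const measurable_const)
  unfold signSumFun
  exact (h.comp (measurable_fst.mul measurable_snd)).mul (by fun_prop)

/-- The joint density of the two estimates, averaged over the prior. -/
noncomputable def mixture (ε τ : ℝ) (v : ℝ≥0) (x y : ℝ) : ℝ :=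
  (1 - ε) * (gaussianPDFReal 0 v y * gaussianPDFReal 0 v x)
    + ε * (gaussianPDFReal τ v y * gaussianPDFReal τ v x)

/-- The marginal-posterior statistic as a function of the two estimates. -/
noncomputable def marginalFun (ε τ : ℝ) (v : ℝ≥0) (z : ℝ × ℝ) : ℝ :=
  Real.log (mixture ε τ v z.1 z.2 / mixture ε τ v z.1 (-z.2))

theorem measurable_marginalFun (ε τ : ℝ) (v : ℝ≥0) : Measurable (marginalFun ε τ v) := by
  have := measurable_gaussianPDFReal 0 v
  have := measurable_gaussianPDFReal τ v
  unfold marginalFun mixture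
  fun_prop

theorem integral_prior {ϑ r : ℝ} {p : ℕ} (h0 : 0 ≤ eps ϑ p) (h1 : eps ϑ p ≤ 1) (f : ℝ → ℝ) :
    ∫ b, f b ∂(prior ϑ r p) = (1 - eps ϑ p) * f 0 + eps ϑ p * f (tau r p) := by
  rw [prior, integral_add_measure, integral_smul_measure, integral_smul_measure, integral_dirac,
    integral_dirac, ENNReal.toReal_ofReal (by linarith), ENNReal.toReal_ofReal h0, smul_eq_mul,
    smul_eq_mul]
  · exact (integrable_dirac (by simp)).smul_measure ENNReal.ofReal_ne_top
  · exact (integrable_dirac (by simp)).smul_measure ENNReal.ofReal_ne_top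

/-- The two posterior means share the normalizing constant, the marginal density of the first
estimate. It cancels and leaves a ratio of joint marginal densities. -/
theorem marginalMirror_eq {ϑ r θ : ℝ} {n p : ℕ} (X₁ X₂ : Matrix (Fin n) (Fin p) ℝ) (hθ : 0 < θ)
    (hd₁ : ∀ j, (X₁ᵀ * X₁)⁻¹ j j = θ) (hd₂ : ∀ j, (X₂ᵀ * X₂)⁻¹ j j = θ)
    (h0 : 0 < eps ϑ p) (h1 : eps ϑ p ≤ 1) (s : Sample n p) (j : Fin p) :
    marginalMirror (prior ϑ r p) X₁ X₂ s j =
      marginalFun (eps ϑ p) (tau r p) θ.toNNReal (betaHat₁ X₁ s j, betaHat₂ X₂ s j) := by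
  have hv : θ.toNNReal ≠ 0 := by simpa using hθ
  simp only [marginalMirror, posteriorMean, likelihood, hd₁, hd₂]
  rw [integral_prior h0.le h1, integral_prior h0.le h1, integral_prior h0.le h1, marginalFun,
    div_div_div_cancel_right₀]
  · rfl
  · have := mul_nonneg (sub_nonneg.2 h1)
      (gaussianPDFReal_nonneg 0 θ.toNNReal (betaHat₁ X₁ s j))
    have := mul_pos h0 (gaussianPDFReal_pos (tau r p) θ.toNNReal (betaHat₁ X₁ s j) hv)
    linarith

/-! ### Joint densities and the Bayes risk -/

/-- Joint density of two independent normal variables with the same law. -/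
noncomputable def pairDensity (m : ℝ) (v : ℝ≥0) (z : ℝ × ℝ) : ℝ :=
  gaussianPDFReal m v z.1 * gaussianPDFReal m v z.2

theorem pairDensity_pos (m : ℝ) {v : ℝ≥0} (hv : v ≠ 0) (z : ℝ × ℝ) : 0 < pairDensity m v z :=
  mul_pos (gaussianPDFReal_pos _ _ _ hv) (gaussianPDFReal_pos _ _ _ hv)

theorem measurable_pairDensity (m : ℝ) (v : ℝ≥0) : Measurable (pairDensity m v) := by
  have := measurable_gaussianPDFReal m v
  unfold pairDensity
  fun_prop

theorem const_mul_pairLaw_apply (m : ℝ) {v : ℝ≥0} (hv : v ≠ 0) {c : ℝ} (hc : 0 ≤ c)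
    {S : Set (ℝ × ℝ)} (hS : MeasurableSet S) :
    ENNReal.ofReal c * pairLaw m v S = ∫⁻ z in S, ENNReal.ofReal (c * pairDensity m v z) := by
  have h : pairLaw m v S = ∫⁻ z in S, ENNReal.ofReal (pairDensity m v z) := by
    rw [pairLaw, gaussianReal_of_var_ne_zero m hv,
      prod_withDensity (measurable_gaussianPDF m v) (measurable_gaussianPDF m v),
      withDensity_apply _ hS]
    simp_rw [gaussianPDF, pairDensity, ENNReal.ofReal_mul (gaussianPDFReal_nonneg _ _ _)]
    rfl
  rw [h, ← lintegral_const_mul _ (measurable_pairDensity m v).ennreal_ofReal]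
  simp_rw [ENNReal.ofReal_mul hc]

/-- The likelihood ratio depends on `z.1 + z.2` alone, so the Bayes test thresholds the sum. -/
theorem pairDensity_shift (τ : ℝ) {v : ℝ≥0} (hv : v ≠ 0) (z : ℝ × ℝ) :
    pairDensity τ v z = pairDensity 0 v z * Real.exp ((τ * (z.1 + z.2) - τ ^ 2) / v) := by
  have hv0 : (v : ℝ) ≠ 0 := by exact_mod_cast hv
  simp only [pairDensity, gaussianPDFReal_def]
  have : Real.exp (-(z.1 - τ) ^ 2 / (2 * v)) * Real.exp (-(z.2 - τ) ^ 2 / (2 * v)) =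
      Real.exp (-(z.1 - 0) ^ 2 / (2 * v)) * Real.exp (-(z.2 - 0) ^ 2 / (2 * v)) *
        Real.exp ((τ * (z.1 + z.2) - τ ^ 2) / v) := by
    rw [← Real.exp_add, ← Real.exp_add, ← Real.exp_add]
    congr 1
    field_simp
    ring
  linear_combination ((√(2 * Real.pi * v))⁻¹ * (√(2 * Real.pi * v))⁻¹) * this

theorem pairDensity_zero_reflect (v : ℝ≥0) (x y : ℝ) :
    pairDensity 0 v (x, -y) = pairDensity 0 v (x, y) := by
  simp [pairDensity, gaussianPDFReal_def]

/-- The minimal risk over all tests. -/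
noncomputable def bayesRisk (ε τ : ℝ) (v : ℝ≥0) : ℝ≥0∞ :=
  ∫⁻ z, ENNReal.ofReal (min ((1 - ε) * pairDensity 0 v z) (ε * pairDensity τ v z))

theorem risk_eq {ε : ℝ} (h0 : 0 ≤ ε) (h1 : ε ≤ 1) (τ : ℝ) {v : ℝ≥0} (hv : v ≠ 0)
    {S : Set (ℝ × ℝ)} (hS : MeasurableSet S) :
    risk ε τ v S = (∫⁻ z in S, ENNReal.ofReal ((1 - ε) * pairDensity 0 v z))
      + ∫⁻ z in Sᶜ, ENNReal.ofReal (ε * pairDensity τ v z) := by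
  rw [risk, const_mul_pairLaw_apply 0 hv (by linarith) hS,
    const_mul_pairLaw_apply τ hv h0 hS.compl]

/-- Neyman-Pearson: each point contributes one of the two weighted densities, hence at least their
minimum. -/
theorem bayesRisk_le_risk {ε : ℝ} (h0 : 0 ≤ ε) (h1 : ε ≤ 1) (τ : ℝ) {v : ℝ≥0} (hv : v ≠ 0)
    {S : Set (ℝ × ℝ)} (hS : MeasurableSet S) : bayesRisk ε τ v ≤ risk ε τ v S := by
  rw [risk_eq h0 h1 τ hv hS, bayesRisk, ← lintegral_add_compl _ hS]
  gcongr
  · exact min_le_left _ _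
  · exact min_le_right _ _

/-- The hypothesis says that the signal term does not exceed the null term at the corner of the box.
The likelihood ratio increases in the sum, so on the whole box the minimum is the signal term and
the box estimate applies. -/
theorem le_bayesRisk {ε : ℝ} (h0 : 0 ≤ ε) {τ : ℝ} (hτ : 0 ≤ τ) {v : ℝ≥0}
    (hv : v ≠ 0) {k : ℝ} (hk : 0 ≤ k)
    (h : ε * Real.exp ((τ ^ 2 - 2 * τ * (√v * k)) / v) ≤ 1 - ε) :
    ENNReal.ofReal (ε * ((k + 1)⁻¹ ^ 2 * (2 * Real.pi)⁻¹ * Real.exp (-(k ^ 2 + 3)))) ≤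
      bayesRisk ε τ v := by
  have hv0 : (0 : ℝ) < v := by positivity
  have hm : MeasurableSet {z : ℝ × ℝ | z.1 ≤ τ - √v * k ∧ z.2 ≤ τ - √v * k} :=
    (measurableSet_le measurable_fst measurable_const).inter
      (measurableSet_le measurable_snd measurable_const)
  rw [ENNReal.ofReal_mul h0]
  refine (mul_le_mul_right (le_pairLaw_box τ hv hk) _).trans ?_
  rw [const_mul_pairLaw_apply τ hv h0 hm]
  refine le_trans ?_ (setLIntegral_le_lintegral
    {z : ℝ × ℝ | z.1 ≤ τ - √v * k ∧ z.2 ≤ τ - √v * k} _)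
  refine setLIntegral_mono' hm fun z hz => ENNReal.ofReal_le_ofReal (le_min ?_ le_rfl)
  rw [pairDensity_shift τ hv]
  have h2 : Real.exp ((τ * (z.1 + z.2) - τ ^ 2) / v) ≤
      Real.exp ((τ ^ 2 - 2 * τ * (√v * k)) / v) := by
    refine Real.exp_le_exp.2 ((div_le_div_iff_of_pos_right hv0).2 ?_)
    have := mul_le_mul_of_nonneg_left (add_le_add hz.1 hz.2) hτ
    linarith
  have h3 := (mul_le_mul_of_nonneg_left h2 h0).trans h
  have := mul_le_mul_of_nonneg_left h3 (pairDensity_pos 0 hv z).le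
  linarith

/-! ### Risk bounds for the two statistics -/

/-- For `t > 0` a rejection forces equal signs, where the statistic is `|z₁ + z₂|`: this gives two
null tails. A missed signal has a small sum or a nonpositive coordinate. -/
theorem risk_signSumFun_le {ε : ℝ} (h0 : 0 ≤ ε) {τ : ℝ} (hτ : 0 ≤ τ) (v : ℝ≥0)
    {t : ℝ} (ht : 0 < t) :
    risk ε τ v {z | t ≤ signSumFun z} ≤ ENNReal.ofReal (2 * Real.exp (-t ^ 2 / (4 * v)) +
      ε * (Real.exp (-(max (2 * τ - t) 0) ^ 2 / (4 * v)) + 2 * Real.exp (-τ ^ 2 / (2 * v)))) := by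
  have hnull : pairLaw 0 v {z | t ≤ signSumFun z} ≤
      ENNReal.ofReal (2 * Real.exp (-t ^ 2 / (4 * v))) := by
    have hsub : {z : ℝ × ℝ | t ≤ signSumFun z} ⊆ {z | t ≤ z.1 + z.2} ∪ {z | z.1 + z.2 ≤ -t} := by
      rintro ⟨x, y⟩ hz
      simp only [Set.mem_ofPred_eq, signSumFun] at hz
      simp only [Set.mem_union, Set.mem_ofPred_eq]
      rcases lt_trichotomy (x * y) 0 with h | h | h
      · rw [Real.sign_of_neg h] at hz
        linarith [abs_nonneg x, abs_nonneg y]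
      · rw [h, Real.sign_zero] at hz
        linarith
      · rw [Real.sign_of_pos h] at hz
        rcases mul_pos_iff.1 h with ⟨hx, hy⟩ | ⟨hx, hy⟩
        · rw [abs_of_pos hx, abs_of_pos hy] at hz
          left; linarith
        · rw [abs_of_neg hx, abs_of_neg hy] at hz
          right; linarith
    refine (measure_mono hsub).trans ((measure_union_le _ _).trans ?_)
    have h1 := pairLaw_add_ge_le v ht.le
    have h2 := pairLaw_add_le_le 0 v (t := -t) (by linarith)
    rw [show -(2 * 0 - -t) ^ 2 = -t ^ 2 by ring] at h2
    refine (add_le_add h1 h2).trans (le_of_eq ?_)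
    rw [← ENNReal.ofReal_add (by positivity) (by positivity), two_mul]
  have halt : pairLaw τ v {z | t ≤ signSumFun z}ᶜ ≤ ENNReal.ofReal
      (Real.exp (-(max (2 * τ - t) 0) ^ 2 / (4 * v)) + 2 * Real.exp (-τ ^ 2 / (2 * v))) := by
    have hsub : {z : ℝ × ℝ | t ≤ signSumFun z}ᶜ ⊆
        {z | z.1 + z.2 ≤ t} ∪ ({z | z.1 ≤ 0} ∪ {z | z.2 ≤ 0}) := by
      rintro ⟨x, y⟩ hz
      simp only [Set.mem_compl_iff, Set.mem_ofPred_eq, signSumFun, not_le] at hz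
      simp only [Set.mem_union, Set.mem_ofPred_eq]
      by_contra! hc
      obtain ⟨h1, hx, hy⟩ := hc
      rw [Real.sign_of_pos (mul_pos hx hy), abs_of_pos hx, abs_of_pos hy] at hz
      linarith
    refine (measure_mono hsub).trans ((measure_union_le _ _).trans ?_)
    have h1 : pairLaw τ v {z | z.1 + z.2 ≤ t} ≤
        ENNReal.ofReal (Real.exp (-(max (2 * τ - t) 0) ^ 2 / (4 * v))) := by
      -- Beyond the mean `2τ` of the sum there is no decay; the truncation by `max` then gives the
      -- trivial bound `1`.
      rcases le_total t (2 * τ) with h | h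
      · rw [max_eq_left (by linarith)]
        exact pairLaw_add_le_le τ v h
      · rw [max_eq_right (by linarith)]
        simpa using prob_le_one
    have h2 := pairLaw_fst_le_le τ v hτ
    have h3 := pairLaw_snd_le_le τ v hτ
    rw [sub_zero] at h2 h3
    refine (add_le_add h1 ((measure_union_le _ _).trans (add_le_add h2 h3))).trans (le_of_eq ?_)
    rw [← ENNReal.ofReal_add (by positivity) (by positivity),
      ← ENNReal.ofReal_add (by positivity) (by positivity), ← two_mul (Real.exp (-τ ^ 2 / _))]
  rw [risk, ENNReal.ofReal_add (by positivity) (by positivity), ENNReal.ofReal_mul h0]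
  refine add_le_add ?_ (mul_le_mul_right halt _)
  refine le_trans (mul_le_mul_left (ENNReal.ofReal_le_one.2 (by linarith)) _) ?_
  rwa [one_mul]

theorem mixture_eq (ε τ : ℝ) (v : ℝ≥0) (x y : ℝ) :
    mixture ε τ v x y = (1 - ε) * pairDensity 0 v (x, y) + ε * pairDensity τ v (x, y) := by
  simp only [mixture, pairDensity]
  ring

/-- Thresholding the marginal-posterior statistic at `log 2` is nearly a Bayes test. -/
theorem risk_marginalFun_le {ε : ℝ} (h0 : 0 < ε) (h1 : ε < 1) {τ : ℝ} (hτ : 0 < τ) {v : ℝ≥0}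
    (hv : v ≠ 0) {K : ℝ} (hK : 1 ≤ K) (hq : 1 ≤ K * (1 - 2 * Real.exp (-τ ^ 2 / (2 * v)))) :
    risk ε τ v {z | Real.log 2 ≤ marginalFun ε τ v z} ≤
      ENNReal.ofReal K * bayesRisk ε τ v
        + ENNReal.ofReal (ε * Real.exp (-(9 / 32 * (τ ^ 2 / v)))) := by
  have hv0 : (0 : ℝ) < v := by positivity
  set R : Set (ℝ × ℝ) := {z | Real.log 2 ≤ marginalFun ε τ v z} with hR
  have hRm : MeasurableSet R := measurableSet_le measurable_const (measurable_marginalFun ε τ v)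
  set G₀ : ℝ × ℝ → ℝ := fun z => (1 - ε) * pairDensity 0 v z with hG₀
  set G₁ : ℝ × ℝ → ℝ := fun z => ε * pairDensity τ v z with hG₁
  have hG₀p : ∀ z, 0 < G₀ z := fun z => mul_pos (by linarith) (pairDensity_pos 0 hv z)
  have hG₁p : ∀ z, 0 < G₁ z := fun z => mul_pos h0 (pairDensity_pos τ hv z)
  have hmix : ∀ z : ℝ × ℝ, z ∈ R ↔ 2 * (G₀ z + G₁ (z.1, -z.2)) ≤ G₀ z + G₁ z := by
    rintro ⟨x, y⟩
    have e1 : mixture ε τ v x y = G₀ (x, y) + G₁ (x, y) := mixture_eq ε τ v x y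
    have e2 : mixture ε τ v x (-y) = G₀ (x, y) + G₁ (x, -y) := by
      rw [mixture_eq, pairDensity_zero_reflect]
    have p1 := hG₀p (x, y)
    have p2 := hG₁p (x, y)
    have p3 := hG₁p (x, -y)
    simp only [hR, Set.mem_ofPred_eq, marginalFun, e1, e2]
    rw [Real.log_le_log_iff two_pos (by positivity), le_div_iff₀ (by positivity)]
  have hrefl : ∀ z : ℝ × ℝ, G₁ (z.1, -z.2) = G₁ z * Real.exp (-(2 * τ * z.2) / v) := by
    rintro ⟨x, y⟩
    simp only [hG₁]
    rw [pairDensity_shift τ hv, pairDensity_shift τ hv (x, y), pairDensity_zero_reflect, mul_assoc,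
      mul_assoc, ← Real.exp_add]
    congr 3
    ring
  -- Off `T` the reflected signal term is at most `exp(-τ²/(2v))` times the signal term. The cutoff
  -- must be low enough for `T` to be negligible against the Bayes risk: `T` costs `(3/4)²/2 = 9/32`
  -- in units of `τ²/v`, the Bayes risk at most `1/4`.
  set T : Set (ℝ × ℝ) := {z | z.2 ≤ τ / 4} with hT
  have hTm : MeasurableSet T := measurableSet_le measurable_snd measurable_const
  have hin : ∀ z ∈ R, G₀ z ≤ K * min (G₀ z) (G₁ z) := by
    intro z hz
    have h2 := (hmix z).1 hz
    have h3 := hG₁p (z.1, -z.2)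
    have h4 : G₀ z ≤ G₁ z := by linarith
    rw [min_eq_left h4]
    nlinarith [hG₀p z]
  -- Acceptance means `G₁ < G₀ + 2G₁'`, with `G₁'` the reflected term; off `T` this gives `G₁(1 -
  -- 2q) ≤ G₀` with `q = exp(-τ²/(2v))`, and `K` absorbs `1 - 2q`.
  have hout : ∀ z ∈ Rᶜ, z ∉ T → G₁ z ≤ K * min (G₀ z) (G₁ z) := by
    intro z hz hzT
    have h2 : G₀ z + G₁ z < 2 * (G₀ z + G₁ (z.1, -z.2)) := not_le.1 fun h => hz ((hmix z).2 h)
    rw [hrefl] at h2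
    have hy : τ / 4 < z.2 := not_le.1 hzT
    have h3 : Real.exp (-(2 * τ * z.2) / v) ≤ Real.exp (-τ ^ 2 / (2 * v)) := by
      refine Real.exp_le_exp.2 ?_
      rw [div_le_div_iff₀ hv0 (by positivity)]
      have : τ * (τ / 4) ≤ τ * z.2 := mul_le_mul_of_nonneg_left hy.le hτ.le
      nlinarith
    have h5 : G₁ z * (1 - 2 * Real.exp (-τ ^ 2 / (2 * v))) ≤ G₀ z := by
      have := mul_le_mul_of_nonneg_left h3 (hG₁p z).le
      linarith
    rw [mul_min_of_nonneg _ _ (by linarith)]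
    refine le_min ?_ (by nlinarith [hG₁p z])
    have h6 := mul_le_mul_of_nonneg_left hq (hG₁p z).le
    have h7 := mul_le_mul_of_nonneg_left h5 (by linarith : 0 ≤ K)
    linarith
  have hTle : ENNReal.ofReal ε * pairLaw τ v T ≤
      ENNReal.ofReal (ε * Real.exp (-(9 / 32 * (τ ^ 2 / v)))) := by
    rw [ENNReal.ofReal_mul h0.le]
    refine mul_le_mul_right ((pairLaw_snd_le_le τ v (by linarith)).trans (le_of_eq ?_)) _
    congr 2
    field_simp
    ring
  refine le_trans ?_ (add_le_add_right hTle _)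
  have hG₁m : Measurable fun z => ENNReal.ofReal (G₁ z) :=
    ((measurable_pairDensity τ v).const_mul ε).ennreal_ofReal
  have hminm : Measurable fun z => ENNReal.ofReal (min (G₀ z) (G₁ z)) :=
    (((measurable_pairDensity 0 v).const_mul _).min
      ((measurable_pairDensity τ v).const_mul _)).ennreal_ofReal
  rw [risk_eq h0.le h1.le τ hv hRm, const_mul_pairLaw_apply τ hv h0.le hTm, bayesRisk,
    ← lintegral_const_mul _ hminm, ← lintegral_add_compl (fun z => ENNReal.ofReal K *
      ENNReal.ofReal (min (G₀ z) (G₁ z))) hRm, add_assoc]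
  have hKm : ∀ z, ENNReal.ofReal K * ENNReal.ofReal (min (G₀ z) (G₁ z)) =
      ENNReal.ofReal (K * min (G₀ z) (G₁ z)) := fun z => (ENNReal.ofReal_mul (by linarith)).symm
  refine add_le_add (setLIntegral_mono' hRm fun z hz => ?_) ?_
  · rw [hKm]
    exact ENNReal.ofReal_le_ofReal (hin z hz)
  · have h2 : ∫⁻ z in T, ENNReal.ofReal (G₁ z) =
        ∫⁻ z, T.indicator (fun z => ENNReal.ofReal (G₁ z)) z := (lintegral_indicator hTm _).symm
    calc ∫⁻ z in Rᶜ, ENNReal.ofReal (G₁ z)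
        ≤ ∫⁻ z in Rᶜ, (ENNReal.ofReal K * ENNReal.ofReal (min (G₀ z) (G₁ z))
            + T.indicator (fun z => ENNReal.ofReal (G₁ z)) z) := by
          refine setLIntegral_mono' hRm.compl fun z hz => ?_
          by_cases hzT : z ∈ T
          · rw [Set.indicator_of_mem hzT]
            exact le_add_self
          · rw [hKm]
            exact (ENNReal.ofReal_le_ofReal (hout z hz hzT)).trans le_self_add
      _ = (∫⁻ z in Rᶜ, ENNReal.ofReal K * ENNReal.ofReal (min (G₀ z) (G₁ z)))
            + ∫⁻ z in Rᶜ, T.indicator (fun z => ENNReal.ofReal (G₁ z)) z :=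
          lintegral_add_left (hminm.const_mul _) _
      _ ≤ _ := by
          refine add_le_add_right ?_ _
          exact (setLIntegral_le_lintegral _ _).trans h2.ge

/-! ### Rates in powers of `p` -/

theorem eps_eq_exp (ϑ : ℝ) {p : ℕ} (hp : 0 < p) : eps ϑ p = Real.exp (-ϑ * Real.log p) := by
  rw [eps, Real.rpow_def_of_pos (by exact_mod_cast hp), mul_comm]

theorem tau_eq (r : ℝ) {θ : ℝ} (hθ : 0 < θ) (p : ℕ) :
    tau r p = √θ * √(2 * r / θ * Real.log p) := by
  rw [tau, ← Real.sqrt_mul hθ.le]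
  congr 1
  field_simp

theorem tau_sq_div {r : ℝ} (hr : 0 < r) (θ : ℝ) (p : ℕ) :
    tau r p ^ 2 / θ = 2 * r / θ * Real.log p := by
  rw [tau, Real.sq_sqrt (mul_nonneg (by linarith) (Real.log_natCast_nonneg p))]
  ring

theorem natCast_mul_ofReal_exp {p : ℕ} (hp : 0 < p) (a x : ℝ) :
    (p : ℝ≥0∞) * ENNReal.ofReal (x * Real.exp (a * Real.log p)) =
      ENNReal.ofReal (x * (p : ℝ) ^ (1 + a)) := by
  have hp' : (0 : ℝ) < p := by exact_mod_cast hp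
  rw [← ENNReal.ofReal_natCast, ← ENNReal.ofReal_mul hp'.le, Real.rpow_add hp', Real.rpow_one,
    Real.rpow_def_of_pos hp', mul_comm (Real.log p) a]
  congr 1
  ring

/-- The exponent lost by the Bayes risk is at most `b/4`. It therefore dominates both the sign
errors, of exponent `b/2`, and the event `z₂ ≤ τ/4`, of exponent `9b/32`. -/
theorem sq_div_le {ϑ b : ℝ} (hϑ : 0 < ϑ) (hb : 0 < b) :
    (max (b - ϑ) 0) ^ 2 / (4 * b) ≤ b / 4 := by
  rw [div_le_div_iff₀ (by positivity) (by norm_num)]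
  have h1 : max (b - ϑ) 0 ≤ b := max_le (by linarith) hb.le
  have h2 : 0 ≤ max (b - ϑ) 0 := le_max_right _ _
  nlinarith

theorem exists_le_bayesRisk {ϑ r θ : ℝ} (hr : 0 < r) (hθ : 0 < θ) :
    ∃ c : ℝ, 0 < c ∧ ∀ p : ℕ, 0 < p → 1 ≤ Real.log p → eps ϑ p ≤ 1 / 2 →
      ENNReal.ofReal (c / Real.log p *
          (p : ℝ) ^ (1 - ϑ - (max (2 * r / θ - ϑ) 0) ^ 2 / (4 * (2 * r / θ)))) ≤
        p * bayesRisk (eps ϑ p) (tau r p) θ.toNNReal := by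
  have hb : 0 < 2 * r / θ := by positivity
  set b := 2 * r / θ with hbdef
  set M := max (b - ϑ) 0 with hM
  have hM0 : 0 ≤ M := le_max_right _ _
  have hM1 : b - ϑ ≤ M := le_max_left _ _
  set D := M ^ 2 / (4 * b) with hD
  have hD0 : 0 ≤ D := by positivity
  have hl2 : 0 < Real.log 2 := Real.log_pos (by norm_num)
  set C := M * Real.log 2 / (2 * b) + Real.log 2 ^ 2 / (4 * b) with hC
  have hC0 : 0 < C := by positivity
  refine ⟨(2 * (D + C + 1))⁻¹ * (2 * Real.pi)⁻¹ * Real.exp (-(C + 3)), by positivity,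
    fun p hp hL he => ?_⟩
  have hv : θ.toNNReal ≠ 0 := by simpa using hθ
  have hvθ : ((θ.toNNReal : ℝ≥0) : ℝ) = θ := Real.coe_toNNReal _ hθ.le
  set ℓ := Real.log p with hℓ
  have hℓ0 : 0 < ℓ := by linarith
  have hε : eps ϑ p = Real.exp (-ϑ * ℓ) := eps_eq_exp ϑ hp
  have hw : 0 < √(b * ℓ) := Real.sqrt_pos.2 (by positivity)
  have hw2 : √(b * ℓ) ^ 2 = b * ℓ := Real.sq_sqrt (by positivity)
  set w := √(b * ℓ) with hwdef
  have hτ : tau r p = √θ * w := tau_eq r hθ p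
  -- Chosen so that the likelihood ratio at the corner of the box is `exp((b - M)ℓ)/2`. As `b - M ≤
  -- ϑ`, multiplying by `ε = exp(-ϑℓ)` leaves at most `1/2 ≤ 1 - ε`, while `k² = Dℓ + O(1)`.
  set k := (M * ℓ + Real.log 2) / (2 * w) with hk
  have hk0 : 0 ≤ k := by positivity
  have hwk : 2 * (w * k) = M * ℓ + Real.log 2 := by rw [hk]; field_simp
  have hksq : k ^ 2 ≤ D * ℓ + C := by
    have h1 : k ^ 2 = D * ℓ + (M * Real.log 2 / (2 * b) + Real.log 2 ^ 2 / (4 * b) / ℓ) := by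
      rw [hk, div_pow, mul_pow, hw2, hD]
      field_simp
      ring
    have h2 : Real.log 2 ^ 2 / (4 * b) / ℓ ≤ Real.log 2 ^ 2 / (4 * b) :=
      div_le_self (by positivity) hL
    rw [h1, hC]
    linarith
  have hcond : eps ϑ p * Real.exp ((tau r p ^ 2 - 2 * tau r p *
      (√(θ.toNNReal : ℝ) * k)) / (θ.toNNReal : ℝ)) ≤ 1 - eps ϑ p := by
    have h1 : (tau r p ^ 2 - 2 * tau r p * (√(θ.toNNReal : ℝ) * k)) / (θ.toNNReal : ℝ) =
        b * ℓ - (M * ℓ + Real.log 2) := by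
      rw [hvθ, hτ, ← hwk, ← hw2]
      have : √θ ^ 2 = θ := Real.sq_sqrt hθ.le
      rw [div_eq_iff hθ.ne']
      linear_combination (w ^ 2 - 2 * w * k) * this
    rw [h1, hε, ← Real.exp_add]
    refine le_trans (Real.exp_le_exp.2 (?_ : _ ≤ -Real.log 2)) ?_
    · nlinarith
    · rw [Real.exp_neg, Real.exp_log two_pos, ← hε]
      linarith
  have hmain := le_bayesRisk (Real.exp_pos _ |>.le.trans hε.ge) (by rw [hτ]; positivity) hv hk0 hcond
  refine le_trans ?_ (mul_le_mul_right hmain _)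
  rw [show 1 - ϑ - D = 1 + (-ϑ - D) by ring, ← natCast_mul_ofReal_exp hp, ← hℓ]
  refine mul_le_mul_right (ENNReal.ofReal_le_ofReal ?_) _
  -- From `(k+1)² ≤ 2(k²+1)` and `ℓ ≥ 1`; this is the source of the factor `1 / log p`.
  have h1 : ((2 * (D + C + 1)) * ℓ)⁻¹ ≤ (k + 1)⁻¹ ^ 2 := by
    rw [inv_pow]
    refine inv_anti₀ (by positivity) ?_
    nlinarith [sq_nonneg (k - 1)]
  have h2 : Real.exp (-(C + 3)) * Real.exp (-D * ℓ) ≤ Real.exp (-(k ^ 2 + 3)) := by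
    rw [← Real.exp_add]
    refine Real.exp_le_exp.2 ?_
    linarith
  have h3 : Real.exp ((-ϑ - D) * ℓ) = eps ϑ p * Real.exp (-D * ℓ) := by
    rw [hε, ← Real.exp_add]; congr 1; ring
  rw [h3]
  calc _ = eps ϑ p * ((((2 * (D + C + 1)) * ℓ)⁻¹ * (2 * Real.pi)⁻¹) *
        (Real.exp (-(C + 3)) * Real.exp (-D * ℓ))) := by
        rw [mul_inv (2 * (D + C + 1)) ℓ, div_eq_mul_inv]; ring
    _ ≤ _ := by
        refine mul_le_mul_of_nonneg_left ?_ (by rw [hε]; positivity)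
        gcongr

theorem risk_signSumFun_le_rpow {ϑ r θ : ℝ} (hϑ : 0 < ϑ) (hr : 0 < r) (hθ : 0 < θ) {p : ℕ}
    (hp : 0 < p) (hL : 1 ≤ Real.log p) :
    ∃ u : ℝ, 0 < u ∧ p * risk (eps ϑ p) (tau r p) θ.toNNReal
        {z | √(2 * u * Real.log p) ≤ signSumFun z} ≤
      ENNReal.ofReal (5 *
          (p : ℝ) ^ (1 - ϑ - (max (2 * r / θ - ϑ) 0) ^ 2 / (4 * (2 * r / θ)))) := by
  have hb : 0 < 2 * r / θ := by positivity
  have hτ2 := tau_sq_div hr θ p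
  have hτsq : tau r p ^ 2 = 2 * r * Real.log p := Real.sq_sqrt (by positivity)
  set b := 2 * r / θ with hbdef
  set M := max (b - ϑ) 0 with hM
  have hM0 : 0 ≤ M := le_max_right _ _
  have hM1 : M ^ 2 ≤ (b - ϑ) ^ 2 := by
    rcases max_cases (b - ϑ) 0 with h | h
    · rw [hM, h.1]
    · rw [hM, h.1]; nlinarith [sq_nonneg (b - ϑ)]
  set D := M ^ 2 / (4 * b) with hD
  set ℓ := Real.log p with hℓ
  have hℓ0 : 0 < ℓ := by linarith
  have hvθ : ((θ.toNNReal : ℝ≥0) : ℝ) = θ := Real.coe_toNNReal _ hθ.le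
  have hε : eps ϑ p = Real.exp (-ϑ * ℓ) := eps_eq_exp ϑ hp
  have hτ : 0 < tau r p := Real.sqrt_pos.2 (by positivity)
  -- The threshold `t = τ(1 + ϑ/b)` solves `ε exp((τt - τ²)/θ) = 1`, the Bayes boundary up to the
  -- factor `1 - ε`. It gives the null tail the exponent `ϑ + (b-ϑ)²/(4b)` and the missed signals `ϑ
  -- + D`.
  have ht : √(2 * (r * ((ϑ + b) / b) ^ 2) * ℓ) = tau r p * ((ϑ + b) / b) := by
    rw [Real.sqrt_eq_iff_mul_self_eq (by positivity) (by positivity)]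
    linear_combination -((ϑ + b) / b) ^ 2 * hτsq
  refine ⟨r * ((ϑ + b) / b) ^ 2, by positivity, ?_⟩
  rw [ht]
  refine (mul_le_mul_right (risk_signSumFun_le (by rw [hε]; positivity) hτ.le _
    (by positivity)) _).trans ?_
  rw [show 1 - ϑ - D = 1 + (-ϑ - D) by ring, ← natCast_mul_ofReal_exp hp, ← hℓ, hvθ]
  refine mul_le_mul_right (ENNReal.ofReal_le_ofReal ?_) _
  have h3 : Real.exp ((-ϑ - D) * ℓ) = eps ϑ p * Real.exp (-D * ℓ) := by
    rw [hε, ← Real.exp_add]; congr 1; ring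
  have hDb : D ≤ b / 4 := sq_div_le hϑ hb
  have e1 : Real.exp (-(tau r p * ((ϑ + b) / b)) ^ 2 / (4 * θ)) ≤ Real.exp ((-ϑ - D) * ℓ) := by
    refine Real.exp_le_exp.2 ?_
    have h1 : -(tau r p * ((ϑ + b) / b)) ^ 2 / (4 * θ) = -(ϑ + (b - ϑ) ^ 2 / (4 * b)) * ℓ := by
      have : -(tau r p * ((ϑ + b) / b)) ^ 2 / (4 * θ) =
        -(tau r p ^ 2 / θ) * ((ϑ + b) / b) ^ 2 / 4 := by ring
      rw [this, hτ2]
      field_simp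
      ring
    rw [h1]
    have h2 : D ≤ (b - ϑ) ^ 2 / (4 * b) := (div_le_div_iff_of_pos_right (by positivity)).2 hM1
    nlinarith
  have e2 : Real.exp (-(max (2 * tau r p - tau r p * ((ϑ + b) / b)) 0) ^ 2 / (4 * θ)) =
      Real.exp (-D * ℓ) := by
    have h1 : max (2 * tau r p - tau r p * ((ϑ + b) / b)) 0 = tau r p / b * M := by
      rw [hM, mul_max_of_nonneg _ _ (by positivity), mul_zero]
      congr 1
      field_simp
      ring
    have h2 : -(tau r p / b * M) ^ 2 / (4 * θ) = -(tau r p ^ 2 / θ) * (M / b) ^ 2 / 4 := by ring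
    rw [h1, h2, hτ2, hD]
    congr 1
    field_simp
  have e3 : Real.exp (-tau r p ^ 2 / (2 * θ)) ≤ Real.exp (-D * ℓ) := by
    refine Real.exp_le_exp.2 ?_
    have h2 : -tau r p ^ 2 / (2 * θ) = -(tau r p ^ 2 / θ) / 2 := by ring
    rw [h2, hτ2]
    nlinarith [mul_le_mul_of_nonneg_right hDb hℓ0.le, mul_pos hb hℓ0]
  have hε0 : 0 ≤ eps ϑ p := by rw [hε]; positivity
  have e3' := mul_le_mul_of_nonneg_left e3 hε0
  rw [e2]
  rw [h3] at e1 ⊢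
  linarith

theorem risk_marginalFun_le_mul_bayesRisk {ϑ r θ c : ℝ} (hϑ : 0 < ϑ) (hr : 0 < r) (hθ : 0 < θ)
    (hc : 0 < c) {p : ℕ} (hp : 0 < p) (hL : 1 ≤ Real.log p)
    (hlow : ENNReal.ofReal (c / Real.log p *
          (p : ℝ) ^ (1 - ϑ - (max (2 * r / θ - ϑ) 0) ^ 2 / (4 * (2 * r / θ)))) ≤
        p * bayesRisk (eps ϑ p) (tau r p) θ.toNNReal)
    (hq : 2 * Real.exp (-(r / θ) * Real.log p) < 1) :
    p * risk (eps ϑ p) (tau r p) θ.toNNReal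
        {z | Real.log 2 ≤ marginalFun (eps ϑ p) (tau r p) θ.toNNReal z} ≤
      ENNReal.ofReal ((1 - 2 * Real.exp (-(r / θ) * Real.log p))⁻¹ +
          c⁻¹ * (Real.log p * Real.exp (-(r / θ / 16) * Real.log p))) *
        (p * bayesRisk (eps ϑ p) (tau r p) θ.toNNReal) := by
  have hb : 0 < 2 * r / θ := by positivity
  have hτ2 := tau_sq_div hr θ p
  have hvθ : ((θ.toNNReal : ℝ≥0) : ℝ) = θ := Real.coe_toNNReal _ hθ.le
  have hv : θ.toNNReal ≠ 0 := by simpa using hθ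
  have hε : eps ϑ p = Real.exp (-ϑ * Real.log p) := eps_eq_exp ϑ hp
  have hq' : Real.exp (-tau r p ^ 2 / (2 * θ)) = Real.exp (-(r / θ) * Real.log p) := by
    rw [show -tau r p ^ 2 / (2 * θ) = -(tau r p ^ 2 / θ) / 2 by ring, hτ2]
    congr 1
    ring
  set q := Real.exp (-(r / θ) * Real.log p) with hqdef
  have hq0 : 0 < q := Real.exp_pos _
  have hq1 : 0 < 1 - 2 * q := by linarith
  have hℓ0 : 0 < Real.log p := by linarith
  have hmain := risk_marginalFun_le (ε := eps ϑ p) (τ := tau r p) (v := θ.toNNReal)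
    (K := (1 - 2 * q)⁻¹) (by rw [hε]; positivity)
    (by rw [hε, Real.exp_lt_one_iff]; nlinarith) (Real.sqrt_pos.2 (by positivity)) hv
    ((one_le_inv₀ hq1).2 (by linarith))
    (by rw [hvθ, hq', inv_mul_cancel₀ hq1.ne'])
  refine (mul_le_mul_right hmain _).trans ?_
  rw [ENNReal.ofReal_add (by positivity) (by positivity), mul_add, add_mul]
  refine add_le_add (le_of_eq (by ring)) ?_
  refine le_trans ?_ (mul_le_mul_right hlow _)
  rw [← ENNReal.ofReal_mul (by positivity), hvθ, hτ2]
  have hD := sq_div_le hϑ hb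
  set D := (max (2 * r / θ - ϑ) 0) ^ 2 / (4 * (2 * r / θ)) with hDdef
  have h1 : eps ϑ p * Real.exp (-(9 / 32 * (2 * r / θ * Real.log p))) =
      1 * Real.exp ((-ϑ - 9 / 16 * (r / θ)) * Real.log p) := by
    rw [hε, ← Real.exp_add, one_mul]; congr 1; ring
  rw [h1, natCast_mul_ofReal_exp hp, one_mul]
  refine ENNReal.ofReal_le_ofReal ?_
  have hp' : (0 : ℝ) < p := by exact_mod_cast hp
  have h2 : c⁻¹ * (Real.log p * Real.exp (-(r / θ / 16) * Real.log p)) *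
      (c / Real.log p * (p : ℝ) ^ (1 - ϑ - D)) = (p : ℝ) ^ (1 - ϑ - D - r / θ / 16) := by
    rw [sub_eq_add_neg (1 - ϑ - D), Real.rpow_add hp', Real.rpow_def_of_pos hp' (-(r / θ / 16)),
      mul_comm (Real.log p) (-(r / θ / 16))]
    field_simp
  rw [h2]
  -- The event `z₂ ≤ τ/4` has exponent `(9/16) r/θ` and `D ≤ (8/16) r/θ`; the gap `r/(16θ)` pays for
  -- the remainder in the constant.
  refine Real.rpow_le_rpow_of_exponent_le (by exact_mod_cast hp) ?_
  have : 2 * r / θ / 4 = r / θ / 2 := by ring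
  linarith

/-- The exponent `2` of the logarithm leaves one spare factor `log p` on the lower side, to absorb
`c`; on the upper side a factor `log p` absorbs `C`. -/
theorem hasHammingRate_of_bounds {H : ℕ → ℝ≥0∞} {f c C : ℝ} (hc : 0 < c)
    (hlow : ∀ᶠ p : ℕ in atTop, ENNReal.ofReal (c / Real.log p * (p : ℝ) ^ f) ≤ H p)
    (hup : ∀ᶠ p : ℕ in atTop, H p ≤ ENNReal.ofReal (C * (p : ℝ) ^ f)) :
    HasHammingRate H f := by
  have hlog : Tendsto (fun p : ℕ => Real.log p) atTop atTop :=
    Real.tendsto_log_atTop.comp tendsto_natCast_atTop_atTop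
  refine ⟨fun p => (H p).toReal / (p : ℝ) ^ f, ⟨2, ?_⟩, ?_⟩
  · filter_upwards [hlow, hup, hlog.eventually_ge_atTop 1, hlog.eventually_ge_atTop c⁻¹,
      hlog.eventually_ge_atTop C, eventually_gt_atTop 0] with p h1 h2 h3 h4 h5 h6
    have hp' : (0 : ℝ) < p := by exact_mod_cast h6
    have hpf : 0 < (p : ℝ) ^ f := Real.rpow_pos_of_pos hp' f
    have hℓ : 0 < Real.log p := by linarith
    have hfin : H p ≠ ∞ := ne_top_of_le_ne_top ENNReal.ofReal_ne_top h2
    rw [Real.rpow_neg hℓ.le, Real.rpow_two, le_div_iff₀ hpf, div_le_iff₀ hpf]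
    constructor
    · refine le_trans ?_ ((ENNReal.ofReal_le_iff_le_toReal hfin).1 h1)
      refine mul_le_mul_of_nonneg_right ?_ hpf.le
      rw [inv_le_comm₀ (by positivity) (by positivity), inv_div, sq, div_eq_mul_inv]
      exact mul_le_mul_of_nonneg_left h4 hℓ.le
    · have h7 : (H p).toReal ≤ max (C * (p : ℝ) ^ f) 0 := by
        rw [← ENNReal.toReal_ofReal']
        exact ENNReal.toReal_mono ENNReal.ofReal_ne_top h2
      refine h7.trans (max_le (mul_le_mul_of_nonneg_right ?_ hpf.le) (by positivity))
      nlinarith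
  · filter_upwards [hup, eventually_gt_atTop 0] with p h2 h6
    have hp' : (0 : ℝ) < p := by exact_mod_cast h6
    have hpf : 0 < (p : ℝ) ^ f := Real.rpow_pos_of_pos hp' f
    rw [div_mul_cancel₀ _ hpf.ne',
      ENNReal.ofReal_toReal (ne_top_of_le_ne_top ENNReal.ofReal_ne_top h2)]

end RareWeak

/-! ### The main theorem -/

theorem mainTheorem7 (ϑ r θ : ℝ) (hϑ0 : 0 < ϑ) (hϑ1 : ϑ < 1) (hr : 0 < r)
    (n : ℕ → ℕ) (X₁ X₂ : ∀ p : ℕ, Matrix (Fin (n p)) (Fin p) ℝ)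
    (Sig : ∀ p : ℕ, Matrix (Fin p) (Fin p) ℝ)
    (hX₁ : ∀ p, (X₁ p)ᵀ * X₁ p = Sig p) (hX₂ : ∀ p, (X₂ p)ᵀ * X₂ p = Sig p)
    (hSig : ∀ p, IsUnit (Sig p)) (hdiag : ∀ p, ∀ j : Fin p, (Sig p)⁻¹ j j = θ) :
    RareWeak.HasHammingRate (fun p => RareWeak.hammStarMarginal ϑ r (X₁ p) (X₂ p))
        (1 - ϑ - (max (2 * r / θ - ϑ) 0) ^ 2 / (4 * (2 * r / θ))) ∧
      RareWeak.HasHammingRate (fun p => RareWeak.hammStarSignSum ϑ r (X₁ p) (X₂ p))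
        (1 - ϑ - (max (2 * r / θ - ϑ) 0) ^ 2 / (4 * (2 * r / θ))) ∧
      limsup (fun p : ℕ => RareWeak.hammStarMarginal ϑ r (X₁ p) (X₂ p) /
        RareWeak.hammStarSignSum ϑ r (X₁ p) (X₂ p)) atTop ≤ 1 := by
  have hU₁ : ∀ p, IsUnit ((X₁ p)ᵀ * X₁ p) := fun p => by rw [hX₁]; exact hSig p
  have hU₂ : ∀ p, IsUnit ((X₂ p)ᵀ * X₂ p) := fun p => by rw [hX₂]; exact hSig p
  have hd₁ : ∀ p j, ((X₁ p)ᵀ * X₁ p)⁻¹ j j = θ := fun p j => by rw [hX₁]; exact hdiag p j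
  have hd₂ : ∀ p j, ((X₂ p)ᵀ * X₂ p)⁻¹ j j = θ := fun p j => by rw [hX₂]; exact hdiag p j
  -- Positivity of `θ` is read off the design with `p = 1`, which has a coordinate.
  have hθ : 0 < θ := by
    rw [← hd₁ 1 0]
    exact RareWeak.inv_gram_diag_pos (X₁ 1) (hU₁ 1) 0
  have hv : θ.toNNReal ≠ 0 := by simpa using hθ
  have hlog : Tendsto (fun p : ℕ => Real.log p) atTop atTop :=
    Real.tendsto_log_atTop.comp tendsto_natCast_atTop_atTop
  have hexp : ∀ a : ℝ, 0 < a → Tendsto (fun p : ℕ => Real.exp (-a * Real.log p)) atTop (nhds 0) :=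
    fun a ha => Real.tendsto_exp_atBot.comp
      ((tendsto_const_mul_atBot_of_neg (by linarith)).2 hlog)
  set f := 1 - ϑ - (max (2 * r / θ - ϑ) 0) ^ 2 / (4 * (2 * r / θ)) with hf
  obtain ⟨c, hc, hlow⟩ := RareWeak.exists_le_bayesRisk (ϑ := ϑ) hr hθ
  set B : ℕ → ℝ≥0∞ := fun p =>
    p * RareWeak.bayesRisk (RareWeak.eps ϑ p) (RareWeak.tau r p) θ.toNNReal with hB
  set K : ℕ → ℝ := fun p => (1 - 2 * Real.exp (-(r / θ) * Real.log p))⁻¹ +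
          c⁻¹ * (Real.log p * Real.exp (-(r / θ / 16) * Real.log p)) with hK
  have hK1 : Tendsto K atTop (nhds 1) := by
    have h1 : Tendsto (fun p : ℕ => (1 - 2 * Real.exp (-(r / θ) * Real.log p))⁻¹) atTop
        (nhds (1 - 2 * 0)⁻¹) :=
      (tendsto_const_nhds.sub ((hexp _ (by positivity)).const_mul 2)).inv₀ (by norm_num)
    have h2 : Tendsto (fun p : ℕ => Real.log p * Real.exp (-(r / θ / 16) * Real.log p)) atTop
        (nhds 0) := by
      have h := (Real.tendsto_pow_mul_exp_neg_atTop_nhds_zero 1).comp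
        ((tendsto_const_mul_atTop_of_pos (by positivity : 0 < r / θ / 16)).2 hlog)
      have h' := h.const_mul (r / θ / 16)⁻¹
      rw [mul_zero] at h'
      refine h'.congr fun p => ?_
      simp only [Function.comp_apply, pow_one, neg_mul]
      field_simp
    simpa [K] using h1.add (h2.const_mul c⁻¹)
  have hε0 : ∀ᶠ p : ℕ in atTop, 0 < RareWeak.eps ϑ p ∧ RareWeak.eps ϑ p ≤ 1 / 2 := by
    filter_upwards [eventually_gt_atTop 0, (hexp ϑ hϑ0).eventually_le_const
      (by norm_num : (0 : ℝ) < 1 / 2)] with p h1 h2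
    rw [RareWeak.eps_eq_exp ϑ h1]
    exact ⟨Real.exp_pos _, h2⟩
  have hlow' : ∀ᶠ p : ℕ in atTop, ENNReal.ofReal (c / Real.log p * (p : ℝ) ^ f) ≤ B p := by
    filter_upwards [eventually_gt_atTop 0, hlog.eventually_ge_atTop 1, hε0] with p h1 h2 h3
    exact hlow p h1 h2 h3.2
  have hstat : ∀ᶠ p : ℕ in atTop,
      B p ≤ RareWeak.hammStarSignSum ϑ r (X₁ p) (X₂ p) ∧
      RareWeak.hammStarSignSum ϑ r (X₁ p) (X₂ p) ≤ ENNReal.ofReal (5 * (p : ℝ) ^ f) ∧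
      B p ≤ RareWeak.hammStarMarginal ϑ r (X₁ p) (X₂ p) ∧
      RareWeak.hammStarMarginal ϑ r (X₁ p) (X₂ p) ≤ ENNReal.ofReal (K p) * B p := by
    filter_upwards [eventually_gt_atTop 0, hlog.eventually_ge_atTop 1, hε0, hlow',
      ((hexp (r / θ) (by positivity)).const_mul 2).eventually_lt_const
        (by norm_num : (2 : ℝ) * 0 < 1)] with p h1 h2 h3 h4 h5
    have hτ : RareWeak.tau r p ≠ 0 := (Real.sqrt_pos.2 (by positivity)).ne'
    have hS := RareWeak.hamm_eq_card_mul_risk (X₁ p) (X₂ p) (hU₁ p) (hU₂ p) (hd₁ p) (hd₂ p)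
      h3.1.le (by linarith) hτ (RareWeak.signSum (X₁ p) (X₂ p)) RareWeak.signSumFun
      RareWeak.measurable_signSumFun (fun s j => rfl)
    have hM := RareWeak.hamm_eq_card_mul_risk (X₁ p) (X₂ p) (hU₁ p) (hU₂ p) (hd₁ p) (hd₂ p)
      h3.1.le (by linarith) hτ (RareWeak.marginalMirror (RareWeak.prior ϑ r p) (X₁ p) (X₂ p))
      _ (RareWeak.measurable_marginalFun _ _ _)
      (fun s j => RareWeak.marginalMirror_eq (X₁ p) (X₂ p) hθ (hd₁ p) (hd₂ p) h3.1
        (by linarith) s j)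
    refine ⟨?_, ?_, ?_, ?_⟩
    · refine le_iInf₂ fun u _ => ?_
      rw [hS]
      exact mul_le_mul_right (RareWeak.bayesRisk_le_risk h3.1.le (by linarith) _ hv
        (measurableSet_le measurable_const RareWeak.measurable_signSumFun)) _
    · obtain ⟨u, hu, h⟩ := RareWeak.risk_signSumFun_le_rpow hϑ0 hr hθ h1 h2
      refine (iInf₂_le u hu).trans ?_
      rw [hS]
      exact h
    · refine le_iInf₂ fun u _ => ?_
      rw [hM]
      exact mul_le_mul_right (RareWeak.bayesRisk_le_risk h3.1.le (by linarith) _ hv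
        (measurableSet_le measurable_const (RareWeak.measurable_marginalFun _ _ _))) _
    · have hl2 : 0 < Real.log 2 := Real.log_pos (by norm_num)
      -- The infimum is taken for each `p` separately, so `u` may shrink with `p` to make the
      -- threshold the constant `log 2`.
      refine (iInf₂_le (Real.log 2 / (2 * Real.log p)) (by positivity)).trans ?_
      rw [hM, show 2 * (Real.log 2 / (2 * Real.log p)) * Real.log p = Real.log 2 by field_simp]
      exact RareWeak.risk_marginalFun_le_mul_bayesRisk hϑ0 hr hθ hc h1 h2 h4 h5
  refine ⟨RareWeak.hasHammingRate_of_bounds (C := 10) hc ?_ ?_,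
    RareWeak.hasHammingRate_of_bounds (C := 5) hc ?_ ?_, ?_⟩
  · filter_upwards [hlow', hstat] with p h1 h2 using h1.trans h2.2.2.1
  · filter_upwards [hstat, hK1.eventually_le_const (by norm_num : (1 : ℝ) < 2)] with p h1 h2
    -- Eventually `K p ≤ 2`, and the Bayes bound is below the sign-sum error, at most `5 p^f`; hence
    -- the constant `10`.
    refine h1.2.2.2.trans ((mul_le_mul' (ENNReal.ofReal_le_ofReal h2)
      (h1.1.trans h1.2.1)).trans (le_of_eq ?_))
    rw [← ENNReal.ofReal_mul (by norm_num)]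
    congr 1
    ring
  · filter_upwards [hlow', hstat] with p h1 h2 using h1.trans h2.1
  · filter_upwards [hstat] with p h1 using h1.2.1
  · have h1 : Tendsto (fun p => ENNReal.ofReal (K p)) atTop (nhds 1) := by
      simpa using ENNReal.tendsto_ofReal hK1
    rw [← h1.limsup_eq]
    refine limsup_le_limsup ?_
    filter_upwards [hstat] with p h
    exact ENNReal.div_le_of_le_mul (h.2.2.2.trans (mul_le_mul_right h.1 _))
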